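/- Let $\mathcal A$ be a unital C$^*$-algebra, $\mathcal D=\{z\in\mathcal A:\|z\|<1\}$, and regard $\mathcal A^2$ (column vectors) as a right $\mathcal A$-module with the form $\theta(\mathbf x,\mathbf y)=x_1^*y_1-x_2^*y_2$. For $z\in\mathcal D$ put $\ell_z=\{\binom{1}{z}a:a\in\mathcal A\}$ and $|z|=(z^*z)^{1/2}$, and let $cr(0,z)$ be the module endomorphism of $\ell_z$ given by $$cr(0,z)\Big(\tbinom{1}{z}a\Big)=\tbinom{1}{z}(1+|z|)(1-|z|)^{-1}a .$$ For $v\in\mathcal A$ write $\hat v=\begin{pmatrix}0&v^*\\ v&0\end{pmatrix}$. A matrix $g$ acts on points by $g\cdot z=(g_{21}+g_{22}z)(g_{11}+g_{12}z)^{-1}$, and $\mathrm{Exp}_0(v)=e^{\hat v}\cdot 0$ is the value at time $1$ of the geodesic $t\mapsto e^{t\hat v}\cdot 0$ of $\mathcal D$ with initial velocity $v\in(T\mathcal D)_0=\mathcal A$. A point $z\in\mathcal D$ is identified with the reflection $\epsilon_z=2q_z-1\in M_2(\mathcal A)$, where $q_z$ is the $\theta$-orthogonal projection onto $\ell_z$,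 and a vector $v\in(T\mathcal D)_0$ with the matrix $X_v=\frac{d}{dt}\big|_{t=0}\,\epsilon_{tv}$. Put $\langle v,w\rangle_0=-\theta(X_v\mathbf e_1,X_w\mathbf e_1)$, where $\mathbf e_1=\binom10$ (this is the coefficient, in the basis $\mathbf e_1$, of an endomorphism of $\ell_0$), and $mod_0(v)=\langle v,v\rangle_0^{1/2}$. **Theorem.** Let $z\in\mathcal D$. There is exactly one $v\in\mathcal A$ with $\mathrm{Exp}_0(v)=z$; denote it by $\mathrm{Log}_0(z)$. Put $\alpha=z\sum_{k\ge 0}\frac{1}{2k+1}(z^*z)^k$. Then $e^{\hat\alpha}$ maps $\ell_0$ isomorphically onto $\ell_z$, with inverse the restriction of $e^{-\hat\alpha}$, and the parallel transport $$cr(0,z)_0:=e^{-\hat\alpha}\,cr(0,z)\,e^{\hat\alpha}:\ell_0\to\ell_0$$ of $cr(0,z)$ along the geodesic from $0$ to $z$ satisfies $$e^{mod_0(\mathrm{Log}_0(z))}=cr(0,z)_0\qquad\text{and, equivalently,}\qquad mod_0(\mathrm{Log}_0(z))=\log\big(cr(0,z)_0\big),$$ where each endomorphism $\varphi$ of $\ell_0$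 is identified with its coefficient $a\in\mathcal A$ in the basis $\mathbf e_1$, $\varphi(\mathbf e_1)=\mathbf e_1a$. -/

import Mathlib

open scoped Matrix

namespace OperatorDisk

noncomputable section

/-- The form `θ(x, y) = x₁* y₁ - x₂* y₂` on `A²`. -/
def theta {A : Type*} [CStarAlgebra A] (x y : Fin 2 → A) : A :=
  star (x 0) * y 0 - star (x 1) * y 1

/-- The generator `(1, z)` of the line attached to the point `z` of the disk; `gen 0 = e₁`. -/
def gen {A : Type*} [CStarAlgebra A] (z : A) : Fin 2 → A := ![1, z]

/-- The rank one right `A`-submodule `ℓ_z = {(1, z) a : a ∈ A}` of `A²`.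
Right `A`-modules are modules over `Aᵐᵒᵖ`. -/
def line {A : Type*} [CStarAlgebra A] (z : A) : Submodule Aᵐᵒᵖ (Fin 2 → A) :=
  Submodule.span Aᵐᵒᵖ {gen z}

theorem gen_mem_line {A : Type*} [CStarAlgebra A] (z : A) : gen z ∈ line z :=
  Submodule.mem_span_singleton_self _

/-- Sanity check: `ℓ_z` consists of the multiples `(1, z) a = (a, z a)`. -/
theorem mem_line_iff {A : Type*} [CStarAlgebra A] (z : A) (x : Fin 2 → A) :
    x ∈ line z ↔ ∃ a : A, x = ![a, z * a] := by
  unfold line gen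
  rw [Submodule.mem_span_singleton]
  constructor
  · rintro ⟨a, rfl⟩
    refine ⟨a.unop, ?_⟩
    ext i
    fin_cases i <;> simp
  · rintro ⟨a, rfl⟩
    refine ⟨MulOpposite.op a, ?_⟩
    ext i
    fin_cases i <;> simp

/-- The matrix `[[0, a*], [a, 0]]`. -/
def hat {A : Type*} [CStarAlgebra A] (a : A) : Matrix (Fin 2) (Fin 2) A :=
  !![0, star a; a, 0]

/-- The action `g · z = (g₂₁ + g₂₂ z)(g₁₁ + g₁₂ z)⁻¹` of `2 × 2` matrices on points. -/
def moebius {A : Type*} [CStarAlgebra A] (g : Matrix (Fin 2) (Fin 2) A) (z : A) : A :=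
  (g 1 0 + g 1 1 * z) * Ring.inverse (g 0 0 + g 0 1 * z)

/-- The exponential map of the disk at the origin: the value at time `1` of the geodesic
`t ↦ exp (t [[0, a*], [a, 0]]) · 0`, which starts at `0` with velocity `a`. -/
def expZero {A : Type*} [CStarAlgebra A] (a : A) : A :=
  moebius (NormedSpace.exp (hat a)) 0

/-- The logarithm map of the disk at the origin: the inverse of `expZero`. -/
def logZero {A : Type*} [CStarAlgebra A] (z : A) : A :=
  Function.invFun expZero z

/-- The element `α = z ∑ₖ (z* z)ᵏ / (2k+1)`. -/
def alpha {A : Type*} [CStarAlgebra A] (z : A) : A :=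
  z * ∑' k : ℕ, (1 / (2 * (k : ℝ) + 1)) • (star z * z) ^ k

/-- The matrix of the `θ`-orthogonal projection `y ↦ x θ(x, x)⁻¹ θ(x, y)` onto the line
generated by `x`. For `θ(x, x) = 1` this is `x θ(x, ·)`. -/
def thetaProj {A : Type*} [CStarAlgebra A] (x : Fin 2 → A) : Matrix (Fin 2) (Fin 2) A :=
  Matrix.of fun i j => x i * Ring.inverse (theta x x) * theta x (Pi.single j 1)

/-- The point `ε_z = 2 q_z - 1` of the space of reflections
`Q_ρ = {ε : ε² = 1, ρ ε positive and invertible}` that corresponds to the point `z` of the disk;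
`q_z` is the `θ`-orthogonal projection onto `ℓ_z`. -/
def reflection {A : Type*} [CStarAlgebra A] (z : A) : Matrix (Fin 2) (Fin 2) A :=
  (2 : ℝ) • thetaProj (gen z) - 1

/-- The tangent vector of `Q_ρ` at `ε_0` that corresponds to the tangent vector `v` of the disk
at `0`: the (entrywise) derivative of `z ↦ ε_z` at `0` in the direction `v`. -/
def tangentZero {A : Type*} [CStarAlgebra A] (v : A) : Matrix (Fin 2) (Fin 2) A :=
  Matrix.of fun i j => deriv (fun t : ℝ => reflection (t • v) i j) 0

/-- The inner product `⟨X, Y⟩ₓ = -θ(X x, Y x)` of tangent vectors of `Q_ρ`, written as the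
coefficient of an endomorphism of the line generated by `x` in the basis `x`. -/
def innerAt {A : Type*} [CStarAlgebra A] (x : Fin 2 → A) (X Y : Matrix (Fin 2) (Fin 2) A) : A :=
  -theta (X *ᵥ x) (Y *ᵥ x)

/-- The `θ`-modulus `⟨v, v⟩₀^{1/2}` of a tangent vector `v` of the disk at `0`, as a coefficient
in the basis `e₁` of `ℓ_0`. -/
def modZero {A : Type*} [CStarAlgebra A] [PartialOrder A] [StarOrderedRing A] (v : A) : A :=
  CFC.sqrt (innerAt (gen 0) (tangentZero v) (tangentZero v))

/-- The element `(1 + |z|)(1 - |z|)⁻¹`, where `|z| = (z* z)^{1/2}`. -/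
def crCoeff {A : Type*} [CStarAlgebra A] [PartialOrder A] [StarOrderedRing A] (z : A) : A :=
  (1 + CFC.abs z) * Ring.inverse (1 - CFC.abs z)

/-- The cross ratio endomorphism `cr(0, z) : ℓ_z → ℓ_z`,
`(1, z) a ↦ (1, z) (1 + |z|)(1 - |z|)⁻¹ a`. Note that `a` is the first entry of `(1, z) a`. -/
def cr {A : Type*} [CStarAlgebra A] [PartialOrder A] [StarOrderedRing A] (z : A) :
    Module.End Aᵐᵒᵖ (line z) where
  toFun x := ⟨MulOpposite.op (crCoeff z * (x : Fin 2 → A) 0) • gen z,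
    Submodule.smul_mem _ _ (gen_mem_line z)⟩
  map_add' x y := by
    ext i
    simp [mul_add]
  map_smul' b x := by
    ext i
    simp [mul_assoc]

/-- The coefficient `a` of an endomorphism `φ` of `ℓ_0` in the basis `e₁`: `φ(e₁) = e₁ a`. -/
def coeffZero {A : Type*} [CStarAlgebra A] (φ : Module.End Aᵐᵒᵖ (line (0 : A))) : A :=
  (φ ⟨gen 0, gen_mem_line 0⟩ : Fin 2 → A) 0

end

end OperatorDisk

/-! With `f(v) := v · (f(t)/t)(|v|)` for odd real functions `f`, that is `f(v) = u f(|v|)` for the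
polar decomposition `v = u |v|`, these operations compose like the functions themselves. Summing
the even and the odd powers of `v̂` shows that the first column of `exp v̂` is `(cosh |v|,
sinh(v))`, whence `Exp₀ v = tanh(v)`, while `α = artanh(z)` by the Taylor series of `artanh`. For
`z = tanh(v)` we have `|z| = tanh |v|`, and `(1 + tanh t) / (1 - tanh t) = exp (2 t)` identifies
the coefficient of `cr(0, z)` with `exp (2 |v|)`, where `2 |v|` is the `θ`-modulus of `v`. The
transport along `exp v̂` only conjugates this coefficient by `cosh |v|`, which commutes with it.
-/

namespace OperatorDisk

open Set Topology

section DSlope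

variable {𝕜 : Type*} [NontriviallyNormedField 𝕜] {f g : 𝕜 → 𝕜} {a x : 𝕜} {s : Set 𝕜}

theorem continuousOn_dslope_of_differentiableAt (hs : ContinuousOn f s)
    (ha : DifferentiableAt 𝕜 f a) : ContinuousOn (dslope f a) s := by
  intro b hb
  obtain rfl | hne := eq_or_ne b a
  · exact (continuousAt_dslope_same.2 ha).continuousWithinAt
  · exact (continuousWithinAt_dslope_of_ne hne).2 (hs b hb)

theorem dslope_comp (hg : DifferentiableAt 𝕜 g (f a)) (hf : DifferentiableAt 𝕜 f a) :
    dslope (g ∘ f) a x = dslope g (f a) (f x) * dslope f a x := by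
  obtain rfl | hne := eq_or_ne x a
  · simp only [dslope_same, deriv_comp x hg hf]
  · rw [dslope_of_ne _ hne, dslope_of_ne _ hne, slope_def_field, slope_def_field,
      Function.comp_apply, Function.comp_apply, ← sub_smul_dslope g, smul_eq_mul]
    ring

theorem dslope_mul_of_eq_zero (hf : DifferentiableAt 𝕜 f a) (hg : DifferentiableAt 𝕜 g a)
    (ha : f a = 0) : dslope (f * g) a x = dslope f a x * g x := by
  obtain rfl | hne := eq_or_ne x a
  · simp [dslope_same, deriv_mul hf hg, ha]
  · simp [dslope_of_ne _ hne, slope_def_field, ha, div_mul_eq_mul_div]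

theorem dslope_congr (h : f =ᶠ[𝓝 a] g) (hx : f x = g x) : dslope f a x = dslope g a x := by
  obtain rfl | hne := eq_or_ne x a
  · simp only [dslope_same, h.deriv_eq]
  · simp only [dslope_of_ne _ hne, slope_def_field, hx, h.eq_of_nhds]

theorem hasSum_dslope_of_odd {c : ℕ → 𝕜} (h0 : f 0 = 0) (h0' : deriv f 0 = c 0)
    (hx : HasSum (fun k => c k * x ^ (2 * k + 1)) (f x)) :
    HasSum (fun k => c k * x ^ (2 * k)) (dslope f 0 x) := by
  obtain rfl | hne := eq_or_ne x 0
  · rw [dslope_same, h0']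
    simpa using hasSum_single (f := fun k => c k * (0 : 𝕜) ^ (2 * k)) 0 fun k hk => by simp [hk]
  · rw [dslope_of_ne _ hne, slope_def_field, h0, sub_zero, sub_zero]
    refine (hx.div_const x).congr_fun fun k => ?_
    field_simp
    ring

end DSlope

section Hyperbolic

theorem differentiable_tanh : Differentiable ℝ Real.tanh := by
  rw [funext Real.tanh_eq_sinh_div_cosh]
  exact Real.differentiable_sinh.div Real.differentiable_cosh fun x => (Real.cosh_pos x).ne'

theorem hasDerivAt_artanh {x : ℝ} (hx : x ∈ Ioo (-1) 1) :
    HasDerivAt Real.artanh (1 - x ^ 2)⁻¹ x := by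
  have hpos : 0 < 1 + x := by linarith [hx.1]
  have hneg : 0 < 1 - x := by linarith [hx.2]
  have hlog : HasDerivAt (fun y => 1 / 2 * Real.log ((1 + y) / (1 - y))) (1 - x ^ 2)⁻¹ x := by
    have h := ((((hasDerivAt_id x).const_add 1).div ((hasDerivAt_id x).const_sub 1) hneg.ne').log
      (div_pos hpos hneg).ne').const_mul (1 / 2)
    refine h.congr_deriv ?_
    have : 1 - x ^ 2 = (1 + x) * (1 - x) := by ring
    simp only [id, Pi.div_apply, this]
    field_simp
    ring
  refine hlog.congr_of_eventuallyEq ?_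
  filter_upwards [isOpen_Ioo.mem_nhds hx] with y hy using
    Real.artanh_eq_half_log (Ioo_subset_Icc_self hy)

theorem hasDerivAt_artanh_zero : HasDerivAt Real.artanh 1 0 := by
  simpa using hasDerivAt_artanh (x := 0) (by simp)

theorem hasSum_artanh {x : ℝ} (hx : |x| < 1) :
    HasSum (fun k : ℕ => 1 / (2 * (k : ℝ) + 1) * x ^ (2 * k + 1)) (Real.artanh x) := by
  obtain ⟨hx1, hx2⟩ := abs_lt.1 hx
  rw [Real.artanh_eq_half_log ⟨hx1.le, hx2.le⟩, Real.log_div (by linarith) (by linarith)]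
  refine ((Real.hasSum_log_sub_log_of_abs_lt_one hx).mul_left (1 / 2)).congr_fun fun k => ?_
  ring

theorem one_add_tanh_div_one_sub_tanh (x : ℝ) :
    (1 + Real.tanh x) / (1 - Real.tanh x) = Real.exp (2 * x) := by
  have hcosh := (Real.cosh_pos x).ne'
  have hexp : Real.cosh x - Real.sinh x ≠ 0 := by
    rw [Real.cosh_sub_sinh]; exact (Real.exp_pos _).ne'
  rw [Real.tanh_eq_sinh_div_cosh, one_add_div hcosh, one_sub_div hcosh,
    div_div_div_cancel_right₀ hcosh, div_eq_iff hexp, Real.cosh_add_sinh, Real.cosh_sub_sinh,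
    ← Real.exp_add]
  ring_nf

end Hyperbolic

theorem hasSum_cfc {ι 𝕜 A : Type*} {p : A → Prop} [RCLike 𝕜] [Ring A] [StarRing A]
    [TopologicalSpace A] [Algebra 𝕜 A] [ContinuousFunctionalCalculus 𝕜 A p]
    {f : ι → 𝕜 → 𝕜} {F : 𝕜 → 𝕜} {u : ι → ℝ} {a : A} (hu : Summable u)
    (hf : ∀ i, ContinuousOn (f i) (spectrum 𝕜 a)) (hfu : ∀ i, ∀ x ∈ spectrum 𝕜 a, ‖f i x‖ ≤ u i)
    (hF : ∀ x ∈ spectrum 𝕜 a, HasSum (fun i => f i x) (F x)) :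
    HasSum (fun i => cfc (f i) a) (cfc F a) := by
  rw [cfc_congr fun x hx => (hF x hx).tsum_eq.symm]
  have hlim := tendsto_cfc_fun (tendstoUniformlyOn_tsum hu hfu)
    (.of_forall fun t => continuousOn_finsetSum t fun i _ => hf i)
  refine hlim.congr fun t => ?_
  rw [← cfc_sum _ _ _ fun i _ => hf i]
  congr 1 with x
  simp

variable {A : Type*} [CStarAlgebra A]

theorem exp_neg_mulVec_exp_mulVec {n : Type*} [Fintype n] [DecidableEq n] (M : Matrix n n A)
    (x : n → A) : NormedSpace.exp (-M) *ᵥ (NormedSpace.exp M *ᵥ x) = x := by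
  let _ : NormedAlgebra ℚ A := NormedAlgebra.restrictScalars ℚ ℝ A
  rw [Matrix.mulVec_mulVec, ← Matrix.exp_add_of_commute _ _ (Commute.neg_left (Commute.refl M)),
    neg_add_cancel, NormedSpace.exp_zero, Matrix.one_mulVec]

theorem hasDerivAt_inverse_theta_gen (v : A) :
    HasDerivAt (fun t : ℝ => Ring.inverse (theta (gen (t • v)) (gen (t • v)))) 0 0 := by
  have htheta : HasDerivAt (fun t : ℝ => theta (gen (t • v)) (gen (t • v))) 0 0 := by
    simpa [theta, gen, smul_smul, ← sq] using
      ((hasDerivAt_pow 2 (0 : ℝ)).smul_const (star v * v)).const_sub 1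
  have hinv := hasFDerivAt_ringInverse (𝕜 := ℝ) (1 : Aˣ)
  have hone : ((1 : Aˣ) : A) = theta (gen ((0 : ℝ) • v)) (gen ((0 : ℝ) • v)) := by
    simp [theta, gen]
  rw [hone] at hinv
  simpa [Function.comp_def] using hinv.comp_hasDerivAt (0 : ℝ) htheta

theorem tangentZero_mulVec_gen_zero (v : A) : tangentZero v *ᵥ gen 0 = ![0, (2 : ℝ) • v] := by
  have hinv := hasDerivAt_inverse_theta_gen v
  have h0 : tangentZero v 0 0 = 0 := by
    simpa [tangentZero, reflection, thetaProj, gen, theta] using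
      ((hinv.const_smul (2 : ℝ)).sub_const 1).deriv
  have h1 : tangentZero v 1 0 = (2 : ℝ) • v := by
    simpa [tangentZero, reflection, thetaProj, gen, theta, Pi.mul_def, Pi.smul_def] using
      ((((hasDerivAt_id (0 : ℝ)).smul_const v).mul hinv).const_smul (2 : ℝ)).deriv
  ext i
  fin_cases i <;> simp [Matrix.mulVec, dotProduct, gen, h0, h1]

variable [PartialOrder A] [StarOrderedRing A]

section OddCalculus

theorem spectrum_abs_subset (v : A) : spectrum ℝ (CFC.abs v) ⊆ Icc 0 ‖v‖ := by
  intro x hx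
  have : Nontrivial A := by
    by_contra h
    rw [not_nontrivial_iff_subsingleton] at h
    simp [spectrum.of_subsingleton] at hx
  refine ⟨spectrum_nonneg_of_nonneg (CFC.abs_nonneg v) hx, ?_⟩
  simpa using (le_abs_self x).trans (spectrum.norm_le_norm_of_mem hx)

theorem hasSum_smul_star_mul_self_pow {v : A} {c : ℕ → ℝ} {F : ℝ → ℝ}
    (hF : ∀ x ∈ Icc 0 ‖v‖, HasSum (fun k => c k * x ^ (2 * k)) (F x)) :
    HasSum (fun k => c k • (star v * v) ^ k) (cfc F (CFC.abs v)) := by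
  have hsum : Summable fun k => ‖c k * ‖v‖ ^ (2 * k)‖ :=
    (hF ‖v‖ ⟨norm_nonneg v, le_rfl⟩).summable.norm
  refine (hasSum_cfc hsum (fun k => by fun_prop) (fun k x hx => ?_)
    fun x hx => hF x (spectrum_abs_subset v hx)).congr_fun fun k => ?_
  · obtain ⟨hx0, hxv⟩ := spectrum_abs_subset v hx
    simp only [norm_mul, norm_pow, norm_norm, Real.norm_of_nonneg hx0]
    gcongr
  · rw [cfc_const_mul .., cfc_pow_id .., pow_mul, CFC.abs_sq]

/-- The odd functional calculus: for an odd function `f`, this is `f(v) = u f(|v|)` in terms of the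
polar decomposition `v = u |v|`. It is encoded without `u`, which need not lie in `A`, as
`v` times the value at `|v|` of `t ↦ f t / t`, continued by `deriv f 0` to `t = 0`. -/
noncomputable def oddCFC (f : ℝ → ℝ) (v : A) : A :=
  v * cfc (dslope f 0) (CFC.abs v)

variable {f g : ℝ → ℝ} {v : A}

theorem oddCFC_congr (h0 : f =ᶠ[𝓝 0] g) (h : EqOn f g (spectrum ℝ (CFC.abs v))) :
    oddCFC f v = oddCFC g v := by
  rw [oddCFC, oddCFC, cfc_congr fun x hx => dslope_congr h0 (h hx)]

theorem oddCFC_id (v : A) : oddCFC id v = v := by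
  have h : dslope (id : ℝ → ℝ) 0 = fun _ => 1 := by
    ext x
    obtain rfl | hne := eq_or_ne x 0
    · simp
    · simp [dslope_of_ne _ hne, slope_def_field, hne]
  rw [oddCFC, h, cfc_const_one .., mul_one]

theorem oddCFC_mul (hf0 : f 0 = 0) (hf : DifferentiableAt ℝ f 0) (hg : DifferentiableAt ℝ g 0)
    (hfc : ContinuousOn f (spectrum ℝ (CFC.abs v)))
    (hgc : ContinuousOn g (spectrum ℝ (CFC.abs v))) :
    oddCFC (f * g) v = oddCFC f v * cfc g (CFC.abs v) := by
  have hfs := continuousOn_dslope_of_differentiableAt hfc hf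
  rw [oddCFC, oddCFC, mul_assoc, ← cfc_mul ..,
    cfc_congr fun x _ => dslope_mul_of_eq_zero hf hg hf0]

theorem abs_oddCFC (hf0 : f 0 = 0) (hf : DifferentiableAt ℝ f 0)
    (hfc : ContinuousOn f (spectrum ℝ (CFC.abs v)))
    (hf_nonneg : ∀ x ∈ spectrum ℝ (CFC.abs v), 0 ≤ f x) :
    CFC.abs (oddCFC f v) = cfc f (CFC.abs v) := by
  have hfs := continuousOn_dslope_of_differentiableAt hfc hf
  refine CFC.sqrt_unique ?_ (cfc_nonneg hf_nonneg)
  have hmul : CFC.abs v * cfc (dslope f 0) (CFC.abs v) = cfc f (CFC.abs v) := by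
    conv_lhs => enter [1]; rw [← cfc_id' ℝ (CFC.abs v)]
    rw [← cfc_mul ..]
    exact cfc_congr fun x _ => by simpa [hf0] using sub_smul_dslope f 0 x
  have hsa : IsSelfAdjoint (cfc f (CFC.abs v)) := cfc_predicate f _
  calc cfc f (CFC.abs v) * cfc f (CFC.abs v)
      = star (CFC.abs v * cfc (dslope f 0) (CFC.abs v)) *
          (CFC.abs v * cfc (dslope f 0) (CFC.abs v)) := by rw [hmul, hsa.star_eq]
    _ = star (cfc (dslope f 0) (CFC.abs v)) * (CFC.abs v * CFC.abs v) *
          cfc (dslope f 0) (CFC.abs v) := by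
        rw [star_mul, (CFC.abs_nonneg v).star_eq]
        simp only [mul_assoc]
    _ = star (oddCFC f v) * oddCFC f v := by
        rw [CFC.abs_mul_abs, oddCFC, star_mul]
        simp only [mul_assoc]

theorem oddCFC_oddCFC (hf0 : f 0 = 0) (hf : DifferentiableAt ℝ f 0)
    (hfc : ContinuousOn f (spectrum ℝ (CFC.abs v)))
    (hf_nonneg : ∀ x ∈ spectrum ℝ (CFC.abs v), 0 ≤ f x) (hg : DifferentiableAt ℝ g 0)
    (hgc : ContinuousOn g (f '' spectrum ℝ (CFC.abs v))) :
    oddCFC g (oddCFC f v) = oddCFC (g ∘ f) v := by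
  have hfs := continuousOn_dslope_of_differentiableAt hfc hf
  have hgs := continuousOn_dslope_of_differentiableAt hgc hg
  have hchain (x : ℝ) : dslope (g ∘ f) 0 x = dslope f 0 x * dslope g 0 (f x) := by
    rw [dslope_comp (by rwa [hf0]) hf, hf0, mul_comm]
  rw [oddCFC, abs_oddCFC hf0 hf hfc hf_nonneg, ← cfc_comp' (dslope g 0) f (CFC.abs v), oddCFC,
    oddCFC, mul_assoc, funext hchain, ← cfc_mul _ (fun x => dslope g 0 (f x)) _ hfs
      (hgs.comp hfc (mapsTo_image _ _))]

end OddCalculus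

section Exponential

theorem hasSum_smul_hat_pow_even {v : A} {c : ℕ → ℝ} {F : ℝ → ℝ}
    (hF : ∀ x ∈ Icc 0 ‖v‖, HasSum (fun k => c k * x ^ (2 * k)) (F x)) :
    HasSum (fun k => c k • hat v ^ (2 * k))
      (Matrix.diagonal ![cfc F (CFC.abs v), cfc F (CFC.abs (star v))]) := by
  have hsq : hat v ^ 2 = Matrix.diagonal ![star v * v, v * star v] := by
    ext i j
    fin_cases i <;> fin_cases j <;> simp [hat, sq]
  have hpow (k : ℕ) : c k • hat v ^ (2 * k) =
      Matrix.diagonal ![c k • (star v * v) ^ k, c k • (v * star v) ^ k] := by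
    rw [pow_mul, hsq, Matrix.diagonal_pow, ← Matrix.diagonal_smul]
    congr 1
    ext i
    fin_cases i <;> rfl
  have hv := hasSum_smul_star_mul_self_pow hF
  have hv' := hasSum_smul_star_mul_self_pow (v := star v) (by rwa [norm_star])
  rw [star_star] at hv'
  simp only [hpow]
  refine HasSum.matrix_diagonal (Pi.hasSum.2 ?_)
  exact Fin.forall_fin_two.2 ⟨hv, hv'⟩

theorem exp_hat (v : A) :
    NormedSpace.exp (hat v) =
      !![cfc Real.cosh (CFC.abs v), oddCFC Real.sinh (star v);
        oddCFC Real.sinh v, cfc Real.cosh (CFC.abs (star v))] := by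
  have hcosh (x : ℝ) : HasSum (fun k => ((2 * k).factorial : ℝ)⁻¹ * x ^ (2 * k)) (Real.cosh x) := by
    simpa only [div_eq_inv_mul] using Real.hasSum_cosh x
  have hsinh (x : ℝ) :
      HasSum (fun k => ((2 * k + 1).factorial : ℝ)⁻¹ * x ^ (2 * k)) (dslope Real.sinh 0 x) :=
    hasSum_dslope_of_odd Real.sinh_zero (by simp)
      (by simpa only [div_eq_inv_mul] using Real.hasSum_sinh x)
  have heven := hasSum_smul_hat_pow_even (v := v) fun x _ => hcosh x
  have hodd : HasSum (fun k => ((2 * k + 1).factorial : ℝ)⁻¹ • hat v ^ (2 * k + 1)) (hat v *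
      Matrix.diagonal ![cfc (dslope Real.sinh 0) (CFC.abs v),
        cfc (dslope Real.sinh 0) (CFC.abs (star v))]) := by
    simpa only [mul_smul_comm, ← pow_succ'] using
      (hasSum_smul_hat_pow_even (v := v) fun x _ => hsinh x).mul_left (hat v)
  have hexp := HasSum.even_add_odd (f := fun n => (n.factorial : ℝ)⁻¹ • hat v ^ n) heven hodd
  rw [NormedSpace.exp_eq_tsum ℝ]
  refine hexp.tsum_eq.trans ?_
  ext i j
  fin_cases i <;> fin_cases j <;> simp [hat, oddCFC, Matrix.vecMul_diagonal]

theorem isUnit_cfc_cosh (v : A) : IsUnit (cfc Real.cosh (CFC.abs v)) :=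
  isUnit_cfc _ _ (by fun_prop) (by cfc_tac) fun x _ => (Real.cosh_pos x).ne'

theorem oddCFC_sinh (v : A) :
    oddCFC Real.sinh v = oddCFC Real.tanh v * cfc Real.cosh (CFC.abs v) := by
  have h : Real.sinh = Real.tanh * Real.cosh := by
    ext x
    rw [Pi.mul_apply, Real.tanh_eq_sinh_div_cosh, div_mul_cancel₀ _ (Real.cosh_pos x).ne']
  rw [h, oddCFC_mul Real.tanh_zero (differentiable_tanh 0) (Real.differentiable_cosh 0)
    differentiable_tanh.continuous.continuousOn (by fun_prop)]

theorem expZero_eq_oddCFC_tanh (v : A) : expZero v = oddCFC Real.tanh v := by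
  simp [expZero, moebius, exp_hat, oddCFC_sinh v, mul_assoc,
    Ring.mul_inverse_cancel _ (isUnit_cfc_cosh v)]

theorem exp_hat_mulVec_gen_zero (v : A) :
    NormedSpace.exp (hat v) *ᵥ gen 0 =
      MulOpposite.op (cfc Real.cosh (CFC.abs v)) • gen (expZero v) := by
  rw [exp_hat, oddCFC_sinh v, expZero_eq_oddCFC_tanh]
  ext i
  fin_cases i <;> simp [gen]

end Exponential

section Logarithm

theorem tanh_nonneg_of_mem_spectrum_abs (v : A) :
    ∀ x ∈ spectrum ℝ (CFC.abs v), 0 ≤ Real.tanh x := fun x hx => by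
  rw [Real.tanh_eq_sinh_div_cosh]
  exact div_nonneg (Real.sinh_nonneg_iff.2 (spectrum_abs_subset v hx).1) (Real.cosh_pos x).le

theorem abs_expZero (v : A) : CFC.abs (expZero v) = cfc Real.tanh (CFC.abs v) := by
  rw [expZero_eq_oddCFC_tanh, abs_oddCFC Real.tanh_zero (differentiable_tanh 0)
    differentiable_tanh.continuous.continuousOn (tanh_nonneg_of_mem_spectrum_abs v)]

theorem oddCFC_artanh_expZero (v : A) : oddCFC Real.artanh (expZero v) = v := by
  have hcont : ContinuousOn Real.artanh (Real.tanh '' spectrum ℝ (CFC.abs v)) := by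
    rintro _ ⟨x, -, rfl⟩
    exact (hasDerivAt_artanh ⟨Real.neg_one_lt_tanh x, Real.tanh_lt_one x⟩).continuousAt
      |>.continuousWithinAt
  have hinv : Real.artanh ∘ Real.tanh = id := funext Real.artanh_tanh
  rw [expZero_eq_oddCFC_tanh, oddCFC_oddCFC Real.tanh_zero (differentiable_tanh 0)
    differentiable_tanh.continuous.continuousOn (tanh_nonneg_of_mem_spectrum_abs v)
    hasDerivAt_artanh_zero.differentiableAt hcont, hinv, oddCFC_id]

theorem expZero_injective : Function.Injective (expZero : A → A) :=
  Function.LeftInverse.injective oddCFC_artanh_expZero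

theorem logZero_expZero (v : A) : logZero (expZero v) = v :=
  Function.leftInverse_invFun expZero_injective v

variable {z : A}

theorem alpha_eq_oddCFC_artanh (hz : ‖z‖ < 1) : alpha z = oddCFC Real.artanh z := by
  rw [alpha, oddCFC, (hasSum_smul_star_mul_self_pow fun x hx => ?_).tsum_eq]
  refine hasSum_dslope_of_odd Real.artanh_zero ?_ (hasSum_artanh ?_)
  · simp [hasDerivAt_artanh_zero.deriv]
  · rw [abs_of_nonneg hx.1]
    exact hx.2.trans_lt hz

theorem expZero_alpha (hz : ‖z‖ < 1) : expZero (alpha z) = z := by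
  have hspec : spectrum ℝ (CFC.abs z) ⊆ Ioo (-1) 1 := fun x hx =>
    ⟨by linarith [(spectrum_abs_subset z hx).1], (spectrum_abs_subset z hx).2.trans_lt hz⟩
  have hinv : EqOn (Real.tanh ∘ Real.artanh) id (Ioo (-1) 1) := fun x hx => Real.tanh_artanh hx
  rw [alpha_eq_oddCFC_artanh hz, expZero_eq_oddCFC_tanh, oddCFC_oddCFC Real.artanh_zero
    hasDerivAt_artanh_zero.differentiableAt
    (fun x hx => (hasDerivAt_artanh (hspec hx)).continuousAt.continuousWithinAt)
    (fun x hx => Real.artanh_nonneg (spectrum_abs_subset z hx).1) (differentiable_tanh 0)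
    differentiable_tanh.continuous.continuousOn,
    oddCFC_congr (hinv.eventuallyEq_of_mem (Ioo_mem_nhds (by norm_num) one_pos))
      (hinv.mono hspec), oddCFC_id]

end Logarithm

section Modulus

theorem modZero_eq (v : A) : modZero v = (2 : ℝ) • CFC.abs v := by
  have h : innerAt (gen 0) (tangentZero v) (tangentZero v) =
      star ((2 : ℝ) • v) * ((2 : ℝ) • v) := by
    rw [innerAt, tangentZero_mulVec_gen_zero]
    simp [theta]
  rw [modZero, h, ← CFC.abs, CFC.abs_smul, Real.norm_two]

theorem exp_modZero (v : A) :
    NormedSpace.exp (modZero v) = cfc (fun x => Real.exp (2 * x)) (CFC.abs v) := by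
  rw [modZero_eq, ← CFC.real_exp_eq_normedSpace_exp (by cfc_tac)]
  exact (cfc_comp_smul (2 : ℝ) Real.exp (CFC.abs v)).symm

theorem crCoeff_expZero (v : A) : crCoeff (expZero v) = NormedSpace.exp (modZero v) := by
  have htanh := differentiable_tanh.continuous
  have hne (x : ℝ) : 1 - Real.tanh x ≠ 0 := (sub_pos.2 (Real.tanh_lt_one x)).ne'
  rw [crCoeff, abs_expZero, exp_modZero, ← cfc_const_one ℝ (CFC.abs v), ← cfc_add ..,
    ← cfc_sub .., ← cfc_inv _ _ fun x _ => hne x, ← cfc_mul ..]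
  exact cfc_congr fun x _ => by
    simpa only [div_eq_mul_inv] using one_add_tanh_div_one_sub_tanh x

end Modulus

section Transport

variable {v z : A}

/-- The restriction `ℓ_0 ≃ ℓ_z` of `exp v̂`, which is the parallel transport along the geodesic
`t ↦ exp (t v̂) · 0` from `0` to `z = Exp₀ v`. -/
noncomputable def transport (h : expZero v = z) : line (0 : A) ≃ₗ[Aᵐᵒᵖ] line z :=
  LinearEquiv.ofSubmodules
    (.ofLinearMap (Matrix.mulVecBilin ℝ Aᵐᵒᵖ (NormedSpace.exp (hat v)))
      (Matrix.mulVecBilin ℝ Aᵐᵒᵖ (NormedSpace.exp (-hat v)))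
      (LinearMap.ext fun x => by simpa using exp_neg_mulVec_exp_mulVec (-hat v) x)
      (LinearMap.ext (exp_neg_mulVec_exp_mulVec (hat v))))
    (line 0) (line z) <| by
      rw [line, line, Submodule.map_span, image_singleton]
      refine .trans ?_ (Submodule.span_singleton_smul_eq (isUnit_cfc_cosh v).op (gen z))
      rw [← h, ← exp_hat_mulVec_gen_zero]
      rfl

theorem coeffZero_conj_cr {T : line (0 : A) ≃ₗ[Aᵐᵒᵖ] line z} {c : A}
    (hT : (T ⟨gen 0, gen_mem_line 0⟩ : Fin 2 → A) = MulOpposite.op c • gen z)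
    (hc : Commute c (crCoeff z)) :
    coeffZero (T.symm.toLinearMap ∘ₗ cr z ∘ₗ T.toLinearMap) = crCoeff z := by
  set e : line (0 : A) := ⟨gen 0, gen_mem_line 0⟩ with he
  have hcr : cr z (T e) = MulOpposite.op (crCoeff z) • T e := by
    refine Subtype.ext ?_
    change MulOpposite.op (crCoeff z * (T e : Fin 2 → A) 0) • gen z =
      MulOpposite.op (crCoeff z) • (T e : Fin 2 → A)
    have hT0 : (T e : Fin 2 → A) 0 = c := by simp [hT, gen]
    rw [hT0, hT, smul_smul, ← MulOpposite.op_mul, hc.eq]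
  have hconj : (T.symm.toLinearMap ∘ₗ cr z ∘ₗ T.toLinearMap) e =
      MulOpposite.op (crCoeff z) • e := by
    change T.symm (cr z (T e)) = _
    rw [hcr, map_smul, LinearEquiv.symm_apply_apply]
  rw [coeffZero, hconj]
  simp [he, gen]

theorem coeffZero_transport_cr (h : expZero v = z) :
    coeffZero ((transport h).symm.toLinearMap ∘ₗ cr z ∘ₗ (transport h).toLinearMap) =
      NormedSpace.exp (modZero v) := by
  subst h
  have hc : Commute (cfc Real.cosh (CFC.abs v)) (crCoeff (expZero v)) := by
    rw [crCoeff_expZero, exp_modZero]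
    exact cfc_commute_cfc _ _ _
  rw [coeffZero_conj_cr (exp_hat_mulVec_gen_zero v) hc, crCoeff_expZero]

end Transport

end OperatorDisk

theorem theorem10p1 {A : Type*} [CStarAlgebra A] [PartialOrder A] [StarOrderedRing A]
    (z : A) (hz : ‖z‖ < 1) :
    (∃! v : A, OperatorDisk.expZero v = z) ∧
    ∃ T : OperatorDisk.line (0 : A) ≃ₗ[Aᵐᵒᵖ] OperatorDisk.line z,
      (∀ x : OperatorDisk.line (0 : A),
        (T x : Fin 2 → A) =
          NormedSpace.exp (OperatorDisk.hat (OperatorDisk.alpha z)) *ᵥ (x : Fin 2 → A)) ∧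
      (∀ y : OperatorDisk.line z,
        (T.symm y : Fin 2 → A) =
          NormedSpace.exp (-OperatorDisk.hat (OperatorDisk.alpha z)) *ᵥ (y : Fin 2 → A)) ∧
      NormedSpace.exp (OperatorDisk.modZero (OperatorDisk.logZero z)) =
        OperatorDisk.coeffZero (T.symm.toLinearMap ∘ₗ OperatorDisk.cr z ∘ₗ T.toLinearMap) ∧
      OperatorDisk.modZero (OperatorDisk.logZero z) =
        CFC.log (OperatorDisk.coeffZero
          (T.symm.toLinearMap ∘ₗ OperatorDisk.cr z ∘ₗ T.toLinearMap)) := by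
  have hα := OperatorDisk.expZero_alpha hz
  have hlog : OperatorDisk.logZero z = OperatorDisk.alpha z := by
    rw [← OperatorDisk.logZero_expZero (OperatorDisk.alpha z), hα]
  have hcr := OperatorDisk.coeffZero_transport_cr hα
  have hsa : IsSelfAdjoint (OperatorDisk.modZero (OperatorDisk.alpha z)) :=
    (CFC.sqrt_nonneg _).isSelfAdjoint
  refine ⟨⟨_, hα, fun v hv => OperatorDisk.expZero_injective (hv.trans hα.symm)⟩,
    OperatorDisk.transport hα, fun _ => rfl, fun _ => rfl, ?_, ?_⟩
  · rw [hcr, hlog]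
  · rw [hcr, hlog, CFC.log_exp _ hsa]
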